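/- **Setting.** Let $V=\{Z,A,M,Y\}$ be four random variables (anchor, treatment, mediator, outcome) whose joint law has an almost everywhere positive density $p(Z,A,M,Y)$ with respect to a product of $\sigma$-finite measures (sums for discrete variables; all identities between densities are meant almost everywhere). An *ADMG* $\mathcal G$ on $V$ has directed edges $\to$ without directed cycles and bidirected edges $\leftrightarrow$. In a *CADMG* some vertices $W$ are fixed and no edge has an arrowhead at a fixed vertex; its *districts* are the bidirected-connected components of its random vertices. A random vertex $v$ is *fixable* if no other random vertex is both a descendant of $v$ and joined to $v$ by a bidirected path; *fixing* $v$ removes all edges with an arrowhead into $v$ and divides the current kernel $q$ by $q(v\mid \mathrm{mb}(v),W)$, where $\mathrm{mb}(v)$ consists of the district of $v$ and the parents of that district, without $v$. A set $S$ is fixable if its elements can be fixed one after the other in some order (a valid fixing sequence); for any set $S$, $\phi_S(\mathcal G)$ is $\mathcal G$ with all edges with an arrowhead into $S$ removed and $S$ fixed. A set $D$ is *intrinsic* if $V\setminus D$ is fixable and $D$ is the only district of $\phi_{V\setminus D}(\mathcal G)$. The density $p$ *nested-Markov factorizes* with respect to $\mathcal G$ if there are kernels $q_D(D\mid \mathrm{pa}_{\mathcal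 G}(D))$, one for each intrinsic $D$, such that for every valid fixing sequence $\sigma$ of every fixable set $S$ the kernel obtained from $p$ by fixing along $\sigma$ equals $\prod_{D} q_D(D\mid \mathrm{pa}_{\mathcal G}(D))$, the product over the districts $D$ of $\phi_S(\mathcal G)$. An intervention on $S$ is *identified* in $\mathcal G$ if every district of $\phi_S(\mathcal G)$ is intrinsic in $\mathcal G$. Two vertices are *m-separated* given $C$ if every path between them has a collider without a descendant in $C$ (a vertex being its own descendant) or a non-collider that is in $C$ or fixed. **Assumptions.** Let $p$ nested-Markov factorize with respect to an ADMG $\mathcal G$ such that - (A1) $M$ is a mediator between $A$ and $Y$: $A\to M\to Y$ in $\mathcal G$; - (A2) there is no directed path from $A$ to $Z$ in $\mathcal G$, and in $p$ neither $Z\perp A$ nor $Z\perp Y\mid A,M$ holds; - (A3) (Verma faithfulness) each conditional independence $X\perp X'\mid C$ of two variables in $p$ implies that $X,X'$ are m-separated given $C$ in $\mathcal G$; and whenever $X\perp X'\mid C$ holds, for (almost) every value of $S$, in a kernel $p(V)/\prod_{s\in S}p(s\mid \text{predecessors of } s)$ (predecessors in some topological order of $\mathcal G$; $X,X'\notin S\cup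 C$, $C\cap S=\emptyset$), although $X$ and $X'$ are not conditionally independent in $p$ given any set of other variables, the intervention on $S$ is identified in $\mathcal G$ and $X,X'$ are m-separated given $C$ in $\phi_S(\mathcal G)$. **Claim.** Suppose that $p$ satisfies both the Verma constraint $Z\perp Y$ in the kernel $p(Z,A,M,Y)/p(M\mid A,Z)$ over $(Z,A,Y)$, for (almost) every value of $M$, and the ordinary independence $Z\perp M\mid A$. Then the ADMG $\mathcal G$, with respect to which $p$ nested-Markov factorizes, satisfies the front-door conditions - (F1) there is no edge $A\to Y$, - (F2) there are no edges $A\leftrightarrow M$ and $M\leftrightarrow Y$, and the instrumental-variable conditions - (I1) $Z\to A$ or $Z\leftrightarrow A$ (or both) is in $\mathcal G$, - (I2) $Z$ and $Y$ are m-separated (given $\emptyset$) in the graph obtained from $\mathcal G$ by deleting $A$ and all edges involving $A$. In particular $p$ nested-Markov factorizes with respect to an ADMG satisfying (F1), (F2), (I1), (I2). -/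

import Mathlib

open MeasureTheory
open scoped ENNReal

/-! ### Conditional acyclic directed mixed graphs -/

/-- A conditional acyclic directed mixed graph on the vertex set `V`: `fixed` is the set of fixed
vertices, all other vertices are random, `dir a b` is `a → b` and `bi a b` is `a ↔ b`.
No edge has an arrowhead at a fixed vertex. -/
structure CADMG (V : Type*) where
  fixed : Finset V
  dir : V → V → Prop
  bi : V → V → Prop
  bi_symm : ∀ a b, bi a b → bi b a
  bi_irrefl : ∀ a, ¬ bi a a
  acyclic : ∀ a, ¬ Relation.TransGen dir a a
  dir_head : ∀ a b, dir a b → b ∉ fixed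
  bi_head : ∀ a b, bi a b → b ∉ fixed

/-- An acyclic directed mixed graph: all vertices are random. -/
structure ADMG (V : Type*) extends CADMG V where
  fixed_eq : fixed = ∅

/-- The three ways of traversing an edge from `a` to `b`: `a → b`, `a ← b`, `a ↔ b`. -/
inductive EdgeMark
  | fwd
  | bwd
  | both

namespace EdgeMark

/-- There is an arrowhead at the endpoint at which the traversal arrives. -/
def HeadAtEnd : EdgeMark → Prop
  | fwd => True
  | bwd => False
  | both => True

/-- There is an arrowhead at the endpoint from which the traversal departs. -/
def HeadAtStart : EdgeMark → Prop
  | fwd => False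
  | bwd => True
  | both => True

end EdgeMark

namespace CADMG

variable {V : Type*} [Fintype V] [DecidableEq V]

/-- The random vertices. -/
def random (G : CADMG V) : Finset V := Finset.univ \ G.fixed

/-- Fixing (intervening on) a set of vertices: remove all edges with an arrowhead into it. -/
def fix (G : CADMG V) (S : Finset V) : CADMG V where
  fixed := G.fixed ∪ S
  dir a b := G.dir a b ∧ b ∉ S
  bi a b := G.bi a b ∧ a ∉ S ∧ b ∉ S
  bi_symm a b h := ⟨G.bi_symm a b h.1, h.2.2, h.2.1⟩
  bi_irrefl a h := G.bi_irrefl a h.1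
  acyclic a h := G.acyclic a (Relation.TransGen.mono (fun _ _ h' => h'.1) _ _ h)
  dir_head a b h := by
    rw [Finset.mem_union, not_or]
    exact ⟨G.dir_head a b h.1, h.2⟩
  bi_head a b h := by
    rw [Finset.mem_union, not_or]
    exact ⟨G.bi_head a b h.1, h.2.2⟩

/-- Delete all edges that involve the vertex `v`. The vertex stays in the type as an isolated one,
which is immaterial for separation of other vertices. -/
def deleteVertex (G : CADMG V) (v : V) : CADMG V where
  fixed := G.fixed
  dir a b := G.dir a b ∧ a ≠ v ∧ b ≠ v
  bi a b := G.bi a b ∧ a ≠ v ∧ b ≠ v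
  bi_symm a b h := ⟨G.bi_symm a b h.1, h.2.2, h.2.1⟩
  bi_irrefl a h := G.bi_irrefl a h.1
  acyclic a h := G.acyclic a (Relation.TransGen.mono (fun _ _ h' => h'.1) _ _ h)
  dir_head a b h := G.dir_head a b h.1
  bi_head a b h := G.bi_head a b h.1

open Classical in
/-- The district of `v`: the random vertices joined to `v` by a bidirected path. -/
noncomputable def district (G : CADMG V) (v : V) : Finset V :=
  G.random.filter fun w => Relation.ReflTransGen G.bi v w

/-- The set of all districts (of random vertices). -/
noncomputable def districts (G : CADMG V) : Finset (Finset V) :=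
  G.random.image G.district

open Classical in
/-- The parents of a set of vertices. -/
noncomputable def parents (G : CADMG V) (D : Finset V) : Finset V :=
  Finset.univ.filter fun w => ∃ d ∈ D, G.dir w d

/-- The Markov blanket of `v`: its district and the parents of its district, without `v`. -/
noncomputable def markovBlanket (G : CADMG V) (v : V) : Finset V :=
  (G.district v ∪ G.parents (G.district v)).erase v

/-- A random vertex `v` is fixable if no other random vertex is both a descendant of `v` and
joined to `v` by a bidirected path. -/
def Fixable (G : CADMG V) (v : V) : Prop :=
  v ∈ G.random ∧ ∀ w ∈ G.random, w ≠ v →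
    ¬ (Relation.TransGen G.dir v w ∧ Relation.TransGen G.bi v w)

/-- Valid fixing sequences: each vertex is fixable after the earlier ones have been fixed. -/
def ValidSeq : CADMG V → List V → Prop
  | _, [] => True
  | G, v :: l => G.Fixable v ∧ ValidSeq (G.fix {v}) l

/-- A set is fixable if it can be ordered into a valid fixing sequence. -/
def FixableSet (G : CADMG V) (S : Finset V) : Prop :=
  ∃ l : List V, l.toFinset = S ∧ G.ValidSeq l

/-- `D` is intrinsic if all other random vertices can be fixed, and `D` is then the only
district. -/
def Intrinsic (G : CADMG V) (D : Finset V) : Prop :=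
  D ⊆ G.random ∧ G.FixableSet (G.random \ D) ∧ (G.fix (G.random \ D)).districts = {D}

/-- The distribution after an intervention on `S` is identified from the observed one: it is a
product of intrinsic kernels, i.e. every district of the intervened graph is intrinsic. -/
def Identified (G : CADMG V) (S : Finset V) : Prop :=
  ∀ D ∈ (G.fix S).districts, G.Intrinsic D

/-- `G` has an edge between `a` and `b` which is traversed from `a` to `b` as the mark says. -/
def Edge (G : CADMG V) : EdgeMark → V → V → Prop
  | .fwd, a, b => G.dir a b
  | .bwd, a, b => G.dir b a
  | .both, a, b => G.bi a b

/-- `x` and `y` are m-connected given `C`: there is a path `v 0, …, v n` from `x` to `y` on which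
every collider is an ancestor of (or in) `C` and no non-collider is in `C`. Fixed vertices are
constants, hence count as conditioned on. -/
def MConnected (G : CADMG V) (x y : V) (C : Finset V) : Prop :=
  ∃ (n : ℕ) (v : ℕ → V) (e : ℕ → EdgeMark),
    v 0 = x ∧ v n = y ∧ Set.InjOn v (Set.Iic n) ∧
    (∀ i < n, G.Edge (e i) (v i) (v (i + 1))) ∧
    ∀ i, i + 1 < n →
      ((e i).HeadAtEnd ∧ (e (i + 1)).HeadAtStart →
        ∃ c ∈ C, Relation.ReflTransGen G.dir (v (i + 1)) c) ∧
      (¬ ((e i).HeadAtEnd ∧ (e (i + 1)).HeadAtStart) →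
        v (i + 1) ∉ C ∧ v (i + 1) ∉ G.fixed)

/-- m-separation. -/
def MSeparated (G : CADMG V) (x y : V) (C : Finset V) : Prop := ¬ G.MConnected x y C

end CADMG

/-! ### Densities, kernels and the nested Markov factorization

A kernel `q(R | W)` with random variables `R` and fixed variables `W = V \ R` is a function of all
coordinates, and `lmarginal μ T q` integrates out the coordinates in `T`. -/

section Kernels

variable {V : Type*} [Fintype V] [DecidableEq V] {Ω : V → Type*} [∀ v, MeasurableSpace (Ω v)]

/-- `p` is an (almost everywhere) positive probability density with respect to the product of the
reference measures `μ v`. -/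
structure IsPositiveDensity (μ : ∀ v, Measure (Ω v)) (p : (∀ v, Ω v) → ℝ≥0∞) : Prop where
  measurable : Measurable p
  lintegral_eq_one : ∫⁻ x, p x ∂(Measure.pi μ) = 1
  pos : ∀ᵐ x ∂(Measure.pi μ), 0 < p x

/-- `q(v | B, W)` for a kernel `q(R | W)`. -/
noncomputable def condDensity (μ : ∀ v, Measure (Ω v)) (R : Finset V) (q : (∀ v, Ω v) → ℝ≥0∞)
    (v : V) (B : Finset V) : (∀ v, Ω v) → ℝ≥0∞ :=
  fun x => lmarginal μ (R \ insert v B) q x / lmarginal μ (R \ B) q x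

/-- `X_a` and `X_b` are independent given `X_C` in the kernel `q(R | W)`, for each value of `W`:
`q(a,b,C | W) q(C | W) = q(a,C | W) q(b,C | W)`. -/
def KernelIndep (μ : ∀ v, Measure (Ω v)) (R : Finset V) (q : (∀ v, Ω v) → ℝ≥0∞)
    (a b : V) (C : Finset V) : Prop :=
  ∀ᵐ x ∂(Measure.pi μ),
    lmarginal μ (R \ insert a (insert b C)) q x * lmarginal μ (R \ C) q x =
      lmarginal μ (R \ insert a C) q x * lmarginal μ (R \ insert b C) q x

/-- Ordinary conditional independence of `X_a` and `X_b` given `X_C` in `p(V)`. -/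
def OrdIndep (μ : ∀ v, Measure (Ω v)) (p : (∀ v, Ω v) → ℝ≥0∞) (a b : V) (C : Finset V) : Prop :=
  KernelIndep μ Finset.univ p a b C

/-- Fixing the vertex `v` in the kernel `q` with graph `G`: division by
`q(v | mb(v), W)`. -/
noncomputable def fixKernel (μ : ∀ v, Measure (Ω v)) (G : CADMG V) (q : (∀ v, Ω v) → ℝ≥0∞)
    (v : V) : (∀ v, Ω v) → ℝ≥0∞ :=
  fun x => q x / condDensity μ G.random q v (G.markovBlanket v) x

/-- Fixing the vertices of a list one after the other. -/
noncomputable def fixKernelSeq (μ : ∀ v, Measure (Ω v)) :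
    CADMG V → ((∀ v, Ω v) → ℝ≥0∞) → List V → (∀ v, Ω v) → ℝ≥0∞
  | _, q, [] => q
  | G, q, v :: l => fixKernelSeq μ (G.fix {v}) (fixKernel μ G q v) l

/-- `q` is a kernel `q(D | P)`: it depends on `D ∪ P` only and is a normalized density over `D`
for each value of the other coordinates. -/
structure IsKernel (μ : ∀ v, Measure (Ω v)) (D P : Finset V) (q : (∀ v, Ω v) → ℝ≥0∞) :
    Prop where
  measurable : Measurable q
  dependsOn : DependsOn q ((D ∪ P : Finset V) : Set V)
  normalized : ∀ x, lmarginal μ D q x = 1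

/-- The nested Markov factorization of `p(V)` with respect to an ADMG. -/
def NestedMarkov (μ : ∀ v, Measure (Ω v)) (p : (∀ v, Ω v) → ℝ≥0∞) (G : ADMG V) : Prop :=
  ∃ q : Finset V → (∀ v, Ω v) → ℝ≥0∞,
    (∀ D, G.Intrinsic D → IsKernel μ D (G.parents D) (q D)) ∧
    ∀ l : List V, G.ValidSeq l →
      ∀ᵐ x ∂(Measure.pi μ), fixKernelSeq μ G.toCADMG p l x =
        ∏ D ∈ (G.fix l.toFinset).districts, q D x

/-- `ord` is a topological (causal) order of the vertices of `G`. -/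
def TopologicalOrder (G : ADMG V) (ord : V → ℕ) : Prop :=
  Function.Injective ord ∧ ∀ a b, G.dir a b → ord a < ord b

/-- The post-intervention kernel `p(V) / ∏_{s ∈ S} p(s | predecessors of s)` which the g-formula
computes from `p(V)` along an order of the vertices. -/
noncomputable def gFormula (μ : ∀ v, Measure (Ω v)) (ord : V → ℕ) (S : Finset V)
    (p : (∀ v, Ω v) → ℝ≥0∞) : (∀ v, Ω v) → ℝ≥0∞ :=
  fun x => p x /
    ∏ s ∈ S, condDensity μ Finset.univ p s (Finset.univ.filter fun w => ord w < ord s) x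

/-- Verma faithfulness of `p` to `G`. Ordinary independences in `p` are m-separations in `G`; and
an independence of two variables in a post-intervention kernel obtained from `p`, if these
variables satisfy no ordinary independence in `p`, implies that the post-intervention distribution
is identified in `G` and that they are m-separated in the corresponding CADMG.
(For sets of variables m-separation is pairwise, so pairs suffice.) -/
structure VermaFaithful (μ : ∀ v, Measure (Ω v)) (p : (∀ v, Ω v) → ℝ≥0∞) (G : ADMG V) :
    Prop where
  ordinary : ∀ (a b : V) (C : Finset V), a ≠ b → a ∉ C → b ∉ C →
    OrdIndep μ p a b C → G.MSeparated a b C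
  generalized : ∀ ord : V → ℕ, TopologicalOrder G ord →
    ∀ (S : Finset V) (a b : V) (C : Finset V),
    a ≠ b → a ∉ S → b ∉ S → a ∉ C → b ∉ C → Disjoint C S →
    (∀ C' : Finset V, a ∉ C' → b ∉ C' → ¬ OrdIndep μ p a b C') →
    KernelIndep μ (Finset.univ \ S) (gFormula μ ord S p) a b C →
    G.Identified S ∧ (G.fix S).MSeparated a b C

end Kernels

/-! ### The four variables -/

/-- Anchor `Z`, treatment `A`, mediator `M`, outcome `Y`. -/
inductive Var
  | Z
  | A
  | M
  | Y
  deriving DecidableEq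

instance : Fintype Var where
  elems := {.Z, .A, .M, .Y}
  complete := by intro v; cases v <;> simp

/-- (A1) `M` is a mediator between `A` and `Y`: the path `A → M → Y` is present. -/
def Mediation (G : ADMG Var) : Prop := G.dir .A .M ∧ G.dir .M .Y

/-- (A2) `Z` is not a causal consequence of `A`, `Z` and `A` are dependent, and so are
`Z` and `Y` given `A, M`. -/
def Anchor {Ω : Var → Type*} [∀ v, MeasurableSpace (Ω v)] (μ : ∀ v, Measure (Ω v))
    (p : (∀ v, Ω v) → ℝ≥0∞) (G : ADMG Var) : Prop :=
  ¬ Relation.TransGen G.dir .A .Z ∧ ¬ OrdIndep μ p .Z .A ∅ ∧ ¬ OrdIndep μ p .Z .Y {.A, .M}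

/-- The Verma constraint: `Z` and `Y` are independent in the kernel `p(Z,A,M,Y) / p(M | A,Z)`,
in which `Z, A, Y` are random and `M` is fixed. -/
def VermaConstraint {Ω : Var → Type*} [∀ v, MeasurableSpace (Ω v)] (μ : ∀ v, Measure (Ω v))
    (p : (∀ v, Ω v) → ℝ≥0∞) : Prop :=
  KernelIndep μ {.Z, .A, .Y} (fun x => p x / condDensity μ Finset.univ p .M {.A, .Z} x) .Z .Y ∅

/-- (F1) exclusion restriction. -/
def FrontDoor1 (G : ADMG Var) : Prop := ¬ G.dir .A .Y

/-- (F2) no unmeasured confounding of treatment and mediator or of mediator and outcome. -/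
def FrontDoor2 (G : ADMG Var) : Prop := ¬ G.bi .A .M ∧ ¬ G.bi .M .Y

/-- (I1) `Z → A` or `Z ↔ A`. -/
def Instrument1 (G : ADMG Var) : Prop := G.dir .Z .A ∨ G.bi .Z .A

/-- (I2) `Z` and `Y` are m-separated in the subgraph without `A`. -/
def Instrument2 (G : ADMG Var) : Prop := (G.deleteVertex .A).MSeparated .Z .Y ∅

/-!
The proof combines a pairwise Markov property with faithfulness. By the nested Markov
factorization, fixing childless vertices one after the other integrates them out, so the margin of
`p` on an ancestral set is a product of kernels, one for each district of the induced subgraph. If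
the vertices split into two unions of districts such that neither side involves both `a` and `b`,
this product exhibits `a ⊥ b` given all other variables.

The Markov property on `{Z, A}` turns the dependence of `Z` and `A` into the edge between them (I1).
The independence `Z ⊥ M ∣ A` then excludes all edges between `Z` and `M`, and also `A ↔ M`, since
conditioning on `A` opens the collider `Z ∗→ A ↔ M`. Hence `Z` and `Y` satisfy no ordinary
independence: given `A` or `M` it would exclude `A ↔ Y` as well, and the Markov property on all four
variables would yield `Z ⊥ Y ∣ A, M`; given neither it is violated by the path `Z ∗→ A → M → Y`. So
faithfulness applies to the Verma constraint. Identification of the intervention on `M` excludes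
`M ↔ Y`, and m-separation of `Z` and `Y` after it excludes `A → Y` and the edges between `Z` and
`Y`, which leaves `A` as the only neighbour of `Z`.
-/

theorem exists_forall_not_transGen {V : Type*} [Finite V] {r : V → V → Prop}
    (hr : ∀ a, ¬ Relation.TransGen r a a) {S : Finset V} (hS : S.Nonempty) :
    ∃ v ∈ S, ∀ w ∈ S, ¬ Relation.TransGen r w v := by
  have : Std.Irrefl (Relation.TransGen r) := ⟨hr⟩
  exact (Finite.wellFounded_of_trans_of_irrefl (Relation.TransGen r)).has_min (S : Set V) hS

attribute [ext] CADMG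

namespace CADMG

/-! ### Fixing vertices -/

section Fix

variable {V : Type*} [DecidableEq V]

theorem fix_fix (G : CADMG V) (S T : Finset V) : (G.fix S).fix T = G.fix (S ∪ T) := by
  ext
  all_goals simp only [fix, Finset.mem_union]; tauto

theorem fix_empty (G : CADMG V) : G.fix ∅ = G := by
  ext
  all_goals simp [fix]

theorem Edge.fix {G : CADMG V} {e : EdgeMark} {a b : V} {S : Finset V} (h : G.Edge e a b)
    (ha : a ∉ S) (hb : b ∉ S) : (G.fix S).Edge e a b := by
  cases e
  exacts [⟨h, hb⟩, ⟨h, ha⟩, ⟨h, ha, hb⟩]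

end Fix

/-! ### Districts -/

theorem mem_parents {V : Type*} [Fintype V] {G : CADMG V} {D : Finset V} {w : V} :
    w ∈ G.parents D ↔ ∃ d ∈ D, G.dir w d := by
  simp [parents]

section Districts

variable {V : Type*} [Fintype V] [DecidableEq V] {G : CADMG V} {D S T : Finset V} {v w : V}

theorem mem_random : v ∈ G.random ↔ v ∉ G.fixed := by simp [random]

theorem random_fix (G : CADMG V) (S : Finset V) : (G.fix S).random = G.random \ S := by
  ext v
  simp [random, fix]

theorem mem_district : w ∈ G.district v ↔ w ∈ G.random ∧ Relation.ReflTransGen G.bi v w := by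
  simp [district]

theorem mem_districts : D ∈ G.districts ↔ ∃ v ∈ G.random, G.district v = D := by
  simp [districts]

theorem mem_district_self (hv : v ∈ G.random) : v ∈ G.district v :=
  mem_district.2 ⟨hv, .refl⟩

theorem district_mem_districts (hv : v ∈ G.random) : G.district v ∈ G.districts :=
  mem_districts.2 ⟨v, hv, rfl⟩

theorem district_eq_of_mem (h : w ∈ G.district v) : G.district w = G.district v := by
  have hvw := (mem_district.1 h).2
  have : Std.Symm G.bi := ⟨G.bi_symm⟩
  have hwv := Relation.ReflTransGen.stdSymm.symm _ _ hvw
  ext u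
  simp only [mem_district]
  exact and_congr_right fun _ => ⟨hvw.trans, hwv.trans⟩

theorem eq_district_of_mem (hD : D ∈ G.districts) (hv : v ∈ D) : D = G.district v := by
  obtain ⟨u, -, rfl⟩ := mem_districts.1 hD
  exact (district_eq_of_mem hv).symm

theorem subset_random_of_mem_districts (hD : D ∈ G.districts) : D ⊆ G.random := by
  obtain ⟨v, -, rfl⟩ := mem_districts.1 hD
  exact fun w hw => (mem_district.1 hw).1

theorem mem_of_bi_of_mem_districts (hD : D ∈ G.districts) (h : G.bi v w) (hv : v ∈ D) :
    w ∈ D := by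
  obtain ⟨u, -, rfl⟩ := mem_districts.1 hD
  exact mem_district.2 ⟨mem_random.2 (G.bi_head v w h), (mem_district.1 hv).2.tail h⟩

theorem subset_of_mem_districts (hD : D ∈ G.districts)
    (hT : ∀ a b, G.bi a b → a ∈ T → b ∈ T) (hvD : v ∈ D) (hvT : v ∈ T) : D ⊆ T := by
  intro w hw
  rw [eq_district_of_mem hD hvD, mem_district] at hw
  obtain ⟨-, hvw⟩ := hw
  induction hvw with
  | refl => exact hvT
  | tail _ h ih => exact hT _ _ h ih

theorem insert_markovBlanket (hv : v ∈ G.random) :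
    insert v (G.markovBlanket v) = G.district v ∪ G.parents (G.district v) :=
  Finset.insert_erase (Finset.mem_union_left _ (mem_district_self hv))

theorem parents_fix_of_disjoint (h : Disjoint D S) : (G.fix S).parents D = G.parents D := by
  ext w
  simp only [mem_parents, fix]
  exact exists_congr fun d => and_congr_right fun hd =>
    and_iff_left (Finset.disjoint_left.1 h hd)

theorem districts_fix_random_sdiff (hD : D ∈ G.districts) :
    (G.fix (G.random \ D)).districts = {D} := by
  have hrandom : (G.fix (G.random \ D)).random = D := by
    rw [random_fix, Finset.sdiff_sdiff_eq_self (subset_random_of_mem_districts hD)]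
  have hdistrict : ∀ w ∈ D, (G.fix (G.random \ D)).district w = D := by
    intro w hw
    ext u
    rw [mem_district, hrandom]
    refine ⟨And.left, fun hu => ⟨hu, ?_⟩⟩
    have hwu : Relation.ReflTransGen G.bi w u := by
      rw [eq_district_of_mem hD hw, mem_district] at hu
      exact hu.2
    clear hu
    suffices u ∈ D ∧ Relation.ReflTransGen (G.fix (G.random \ D)).bi w u from this.2
    induction hwu with
    | refl => exact ⟨hw, .refl⟩
    | tail _ h ih =>
      have hmem := mem_of_bi_of_mem_districts hD h ih.1
      exact ⟨hmem, ih.2.tail ⟨h, by simp [ih.1], by simp [hmem]⟩⟩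
  obtain ⟨v, hv⟩ : D.Nonempty := by
    obtain ⟨v, hv, rfl⟩ := mem_districts.1 hD
    exact ⟨v, mem_district_self hv⟩
  rw [districts, hrandom, Finset.image_congr (g := fun _ => D) hdistrict,
    Finset.image_const ⟨v, hv⟩]

/-! ### Fixable sets and intrinsic sets -/

theorem fixable_of_childless (hv : v ∈ G.random) (h : ∀ w, ¬ G.dir v w) : G.Fixable v := by
  refine ⟨hv, fun w _ _ hw => ?_⟩
  obtain ⟨u, hu, -⟩ := Relation.TransGen.head'_iff.1 hw.1
  exact h u hu

theorem fixableSet_random_sdiff (G : CADMG V) (hT : ∀ a b, G.bi a b → a ∈ T → b ∈ T) :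
    G.FixableSet (G.random \ T) := by
  induction hn : (G.random \ T).card generalizing G with
  | zero => exact ⟨[], by simpa using (Finset.card_eq_zero.1 hn).symm, trivial⟩
  | succ n ih =>
    obtain ⟨v, hv, hlast⟩ := exists_forall_not_transGen (r := Function.swap G.dir)
      (S := G.random \ T) (fun a h => G.acyclic a (Relation.transGen_swap.1 h))
      (Finset.card_pos.1 (by omega))
    obtain ⟨hvr, hvT⟩ := Finset.mem_sdiff.1 hv
    have hbi : ∀ w, Relation.TransGen G.bi v w → w ∉ T := by
      intro w hw
      induction hw with
      | single h => exact fun hu => hvT (hT _ _ (G.bi_symm _ _ h) hu)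
      | tail _ h ih => exact fun hu => ih (hT _ _ (G.bi_symm _ _ h) hu)
    have hfix : G.Fixable v := ⟨hvr, fun w hw _ h =>
      hlast w (Finset.mem_sdiff.2 ⟨hw, hbi w h.2⟩) (Relation.transGen_swap.2 h.1)⟩
    have hrandom : (G.fix {v}).random \ T = (G.random \ T).erase v := by
      rw [random_fix, Finset.erase_eq, sdiff_right_comm]
    obtain ⟨l, hl, hvalid⟩ := ih (G.fix {v}) (fun a b h => hT a b h.1)
      (by rw [hrandom, Finset.card_erase_of_mem hv, hn, Nat.add_sub_cancel])
    refine ⟨v :: l, ?_, hfix, hvalid⟩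
    rw [List.toFinset_cons, hl, hrandom, Finset.insert_erase hv]

theorem ValidSeq.append {l l' : List V} (h : G.ValidSeq l)
    (h' : (G.fix l.toFinset).ValidSeq l') : G.ValidSeq (l ++ l') := by
  induction l generalizing G with
  | nil => simpa [fix_empty] using h'
  | cons v l ih =>
    refine ⟨h.1, ih h.2 ?_⟩
    rwa [fix_fix, ← Finset.insert_eq, ← List.toFinset_cons]

theorem ValidSeq.subset_random {l : List V} (h : G.ValidSeq l) : l.toFinset ⊆ G.random := by
  induction l generalizing G with
  | nil => simp
  | cons v l ih =>
    rw [List.toFinset_cons, Finset.insert_subset_iff]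
    exact ⟨h.1.1, (ih h.2).trans (random_fix G {v} ▸ Finset.sdiff_subset)⟩

theorem ValidSeq.intrinsic {l : List V} (h : G.ValidSeq l)
    (hD : D ∈ (G.fix l.toFinset).districts) : G.Intrinsic D := by
  have hDr := subset_random_of_mem_districts hD
  have hsdiff : G.random \ D = l.toFinset ∪ ((G.fix l.toFinset).random \ D) := by
    have := h.subset_random
    rw [random_fix] at hDr ⊢
    grind
  refine ⟨hDr.trans (random_fix G _ ▸ Finset.sdiff_subset), ?_, ?_⟩
  · obtain ⟨l', hl', hvalid⟩ := fixableSet_random_sdiff (T := D) _ fun a b =>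
      mem_of_bi_of_mem_districts hD
    exact ⟨l ++ l', by rw [List.toFinset_append, hl', hsdiff], h.append hvalid⟩
  · rw [hsdiff, ← fix_fix]
    exact districts_fix_random_sdiff hD

theorem ValidSeq.notMem_of_dir_of_bi {l : List V} (h : G.ValidSeq l) (hd : G.dir v w)
    (hb : G.bi v w) (hw : w ∉ l) : v ∉ l := by
  induction l generalizing G with
  | nil => simp
  | cons u l ih =>
    rw [List.mem_cons, not_or] at hw ⊢
    have hvu : v ≠ u := by
      rintro rfl
      exact h.1.2 w (mem_random.2 (G.dir_head _ _ hd)) hw.1 ⟨.single hd, .single hb⟩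
    exact ⟨hvu, ih h.2 ⟨hd, by simpa using hw.1⟩ ⟨hb, by simpa using hvu, by simpa using hw.1⟩
      hw.2⟩

theorem Intrinsic.not_bi_of_dir (hD : G.Intrinsic D) (hd : G.dir v w) (hv : v ∉ D)
    (hw : w ∈ D) : ¬ G.bi v w := by
  intro hb
  obtain ⟨-, ⟨l, hl, hvalid⟩, -⟩ := hD
  have hmem : ∀ u, u ∈ l ↔ u ∈ G.random \ D := fun u => by rw [← hl, List.mem_toFinset]
  have hvr : v ∈ G.random := mem_random.2 (G.bi_head _ _ (G.bi_symm _ _ hb))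
  exact hvalid.notMem_of_dir_of_bi hd hb (by simp [hmem, hw])
    ((hmem v).2 (Finset.mem_sdiff.2 ⟨hvr, hv⟩))

theorem Identified.not_bi_of_dir (hS : G.Identified S) (hd : G.dir v w) (hv : v ∈ S)
    (hw : w ∉ S) : ¬ G.bi v w := by
  have hwr : w ∈ (G.fix S).random :=
    random_fix G S ▸ Finset.mem_sdiff.2 ⟨mem_random.2 (G.dir_head _ _ hd), hw⟩
  refine (hS _ (district_mem_districts hwr)).not_bi_of_dir hd (fun h => ?_) (mem_district_self hwr)
  have hvr := (mem_district.1 h).1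
  rw [random_fix] at hvr
  exact (Finset.mem_sdiff.1 hvr).2 hv

end Districts

/-! ### m-connecting paths -/

section MSeparation

variable {V : Type*} {G : CADMG V} {C : Finset V} {e e' e'' : EdgeMark} {a b c d : V}

/-- The inner vertex `b` of a path, entered through an edge with mark `e` and left through one with
mark `e'`, is open given `C`: this is the condition which `MConnected` puts on each inner vertex. -/
def OpenAt (G : CADMG V) (C : Finset V) (e e' : EdgeMark) (b : V) : Prop :=
  (e.HeadAtEnd ∧ e'.HeadAtStart → ∃ c ∈ C, Relation.ReflTransGen G.dir b c) ∧
    (¬ (e.HeadAtEnd ∧ e'.HeadAtStart) → b ∉ C ∧ b ∉ G.fixed)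

theorem openAt_of_collider (he : e.HeadAtEnd) (he' : e'.HeadAtStart)
    (h : ∃ c ∈ C, Relation.ReflTransGen G.dir b c) : G.OpenAt C e e' b :=
  ⟨fun _ => h, fun hn => (hn ⟨he, he'⟩).elim⟩

theorem openAt_fwd (hC : b ∉ C) (hf : b ∉ G.fixed) : G.OpenAt C e .fwd b :=
  ⟨fun h => h.2.elim, fun _ => ⟨hC, hf⟩⟩

theorem mConnected_of_edge (hab : a ≠ b) (h : G.Edge e a b) : G.MConnected a b C := by
  refine ⟨1, fun | 0 => a | _ => b, fun _ => e, rfl, rfl, ?_, ?_, fun i hi => by omega⟩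
  · intro i hi j hj hij
    simp only [Set.mem_Iic] at hi hj
    interval_cases i <;> interval_cases j <;> simp_all
  · intro i hi
    interval_cases i
    exact h

theorem mConnected_of_two_edges (hnodup : [a, b, c].Nodup) (h : G.Edge e a b)
    (h' : G.Edge e' b c) (hb : G.OpenAt C e e' b) : G.MConnected a c C := by
  refine ⟨2, fun | 0 => a | 1 => b | _ => c, fun | 0 => e | _ => e', rfl, rfl, ?_, ?_, ?_⟩
  · intro i hi j hj hij
    simp only [Set.mem_Iic] at hi hj
    interval_cases i <;> interval_cases j <;> simp_all
  · intro i hi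
    interval_cases i
    exacts [h, h']
  · intro i hi
    obtain rfl : i = 0 := by omega
    exact hb

theorem mConnected_of_three_edges (hnodup : [a, b, c, d].Nodup) (h : G.Edge e a b)
    (h' : G.Edge e' b c) (h'' : G.Edge e'' c d) (hb : G.OpenAt C e e' b)
    (hc : G.OpenAt C e' e'' c) : G.MConnected a d C := by
  refine ⟨3, fun | 0 => a | 1 => b | 2 => c | _ => d, fun | 0 => e | 1 => e' | _ => e'',
    rfl, rfl, ?_, ?_, ?_⟩
  · intro i hi j hj hij
    simp only [Set.mem_Iic] at hi hj
    interval_cases i <;> interval_cases j <;> simp_all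
  · intro i hi
    interval_cases i
    exacts [h, h', h'']
  · intro i hi
    obtain rfl | rfl : i = 0 ∨ i = 1 := by omega
    exacts [hb, hc]

theorem MSeparated.not_edge (h : G.MSeparated a b C) (hab : a ≠ b) : ¬ G.Edge e a b :=
  fun he => h (mConnected_of_edge hab he)

theorem MSeparated.not_bi_of_collider (h : G.MSeparated a c C) (hnodup : [a, b, c].Nodup)
    (he : G.Edge e a b) (hhead : e.HeadAtEnd) (hb : ∃ c ∈ C, Relation.ReflTransGen G.dir b c) :
    ¬ G.bi b c :=
  fun hbc => h (mConnected_of_two_edges (e' := .both) hnodup he hbc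
    (openAt_of_collider hhead trivial hb))

theorem MSeparated.not_dir_of_edge (h : G.MSeparated a c C) (hnodup : [a, b, c].Nodup)
    (he : G.Edge e a b) (hC : b ∉ C) (hf : b ∉ G.fixed) : ¬ G.dir b c :=
  fun hbc => h (mConnected_of_two_edges (e' := .fwd) hnodup he hbc (openAt_fwd hC hf))

theorem mSeparated_deleteVertex (hab : a ≠ b)
    (h : ∀ e w, G.Edge e a w → w = c) : (G.deleteVertex c).MSeparated a b C := by
  rintro ⟨n, v, e, h0, hn, -, hE, -⟩
  rcases Nat.eq_zero_or_pos n with rfl | hpos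
  · exact hab (h0.symm.trans hn)
  have hedge : (G.deleteVertex c).Edge (e 0) a (v 1) := h0 ▸ hE 0 hpos
  revert hedge
  cases e 0
  exacts [fun he => he.2.2 (h .fwd _ he.1), fun he => he.2.1 (h .bwd _ he.1),
    fun he => he.2.2 (h .both _ he.1)]

end MSeparation

end CADMG

/-! ### Marginals of functions of finitely many variables -/

section LMarginal

theorem measurable_finsetProd {ι α M : Type*} [MeasurableSpace α] [CommMonoid M]
    [MeasurableSpace M] [MeasurableMul₂ M] {s : Finset ι} {f : ι → α → M}
    (hf : ∀ i ∈ s, Measurable (f i)) : Measurable (∏ i ∈ s, f i) :=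
  Finset.prod_induction _ _ (fun _ _ => Measurable.mul) measurable_one hf

variable {V : Type*} {Ω : V → Type*} {f g : (∀ v, Ω v) → ℝ≥0∞}

theorem dependsOn_prod {ι M : Type*} [CommMonoid M] {s : Finset ι} {f : ι → (∀ v, Ω v) → M}
    {T : Set V} (hf : ∀ i ∈ s, DependsOn (f i) T) : DependsOn (∏ i ∈ s, f i) T := by
  intro x y h
  simp only [Finset.prod_apply]
  exact Finset.prod_congr rfl fun i hi => hf i hi h

variable [∀ v, MeasurableSpace (Ω v)]

theorem measure_pi_subtype_ne_zero [Fintype V] {μ : ∀ v, Measure (Ω v)}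
    [∀ v, SigmaFinite (μ v)] (h : Measure.pi μ ≠ 0) (s : Finset V) :
    (Measure.pi fun i : s => μ i) ≠ 0 := by
  rw [← Measure.measure_univ_ne_zero, Measure.pi_univ, Finset.prod_ne_zero_iff] at h ⊢
  exact fun i _ => h i (Finset.mem_univ _)

theorem quasiMeasurePreserving_restrict [Fintype V] {μ : ∀ v, Measure (Ω v)}
    [∀ v, SigmaFinite (μ v)] (s : Finset V) :
    Measure.QuasiMeasurePreserving s.restrict (Measure.pi μ) (Measure.pi fun i : s => μ i) := by
  classical
  convert Measure.quasiMeasurePreserving_fst.comp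
    (measurePreserving_piEquivPiSubtypeProd μ (· ∈ s)).quasiMeasurePreserving
  rfl

variable [DecidableEq V] {μ : ∀ v, Measure (Ω v)} {s t : Finset V}

theorem dependsOn_lmarginal {T : Set V} (hf : DependsOn f T) (s : Finset V) :
    DependsOn (lmarginal μ s f) (T \ s) :=
  fun _ _ h => lintegral_congr fun y => hf.updateFinset y h

theorem lmarginal_mul_left (hf : DependsOn f (s : Set V)ᶜ) (hg : Measurable g) :
    lmarginal μ s (f * g) = f * lmarginal μ s g := by
  ext x
  have hfx : ∀ y : ∀ i : s, Ω i, f (Function.updateFinset x s y) = f x := fun y =>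
    hf fun i hi => dif_neg hi
  simp only [lmarginal, Pi.mul_apply, hfx]
  exact lintegral_const_mul _ (hg.comp measurable_updateFinset)

theorem lmarginal_mul_right (hf : Measurable f) (hg : DependsOn g (s : Set V)ᶜ) :
    lmarginal μ s (f * g) = lmarginal μ s f * g := by
  rw [mul_comm, lmarginal_mul_left hg hf, mul_comm]

theorem lmarginal_union_mul [∀ v, SigmaFinite (μ v)] (hst : Disjoint s t) (hf : Measurable f)
    (hg : Measurable g) (hft : DependsOn f (t : Set V)ᶜ) (hgs : DependsOn g (s : Set V)ᶜ) :
    lmarginal μ (s ∪ t) (f * g) = lmarginal μ s f * lmarginal μ t g := by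
  rw [lmarginal_union μ _ (hf.mul hg) hst, lmarginal_mul_left hft hg]
  exact lmarginal_mul_right hf ((dependsOn_lmarginal hgs t).mono Set.sdiff_subset)

variable [Fintype V] [∀ v, SigmaFinite (μ v)]

theorem lmarginal_compl_lmarginal (hf : Measurable f) (s : Finset V) (x : ∀ v, Ω v) :
    lmarginal μ sᶜ (lmarginal μ s f) x = ∫⁻ y, f y ∂(Measure.pi μ) := by
  rw [lintegral_eq_lmarginal_univ x, ← lmarginal_union μ f hf disjoint_compl_left,
    Finset.union_comm, Finset.union_compl]

theorem ae_of_ae_updateFinset {P : (∀ v, Ω v) → Prop} (hP : DependsOn P s) (x₀ : ∀ v, Ω v)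
    (h : ∀ᵐ y ∂(Measure.pi fun i : s => μ i), P (Function.updateFinset x₀ s y)) :
    ∀ᵐ x ∂(Measure.pi μ), P x := by
  filter_upwards [(quasiMeasurePreserving_restrict s).ae h] with x hx
  rwa [hP fun i hi => show Function.updateFinset x₀ s (s.restrict x) i = x i from dif_pos hi] at hx

theorem ae_ae_updateFinset {P : (∀ v, Ω v) → Prop} (hP : ∀ᵐ x ∂(Measure.pi μ), P x)
    (s : Finset V) : ∀ᵐ x ∂(Measure.pi μ), ∀ᵐ y ∂(Measure.pi fun i : s => μ i),
      P (Function.updateFinset x s y) := by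
  rcases isEmpty_or_nonempty (∀ v, Ω v) with _ | ⟨⟨x₀⟩⟩
  · exact .of_forall isEmptyElim
  obtain ⟨N, hPN, hN, hN0⟩ := exists_measurable_superset_of_null hP
  have hI : Measurable (N.indicator (1 : (∀ v, Ω v) → ℝ≥0∞)) := measurable_one.indicator hN
  have hslice : ∀ᵐ x ∂(Measure.pi μ), lmarginal μ s (N.indicator 1) x = 0 := by
    refine ae_of_ae_updateFinset (s := sᶜ) (fun x y h => congrArg (· = 0) ?_) x₀ ?_
    · exact lmarginal_congr _ _ fun i hi => h i (by simpa using hi)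
    · refine (lintegral_eq_zero_iff ((hI.lmarginal μ).comp measurable_updateFinset)).1 ?_
      refine (lmarginal_compl_lmarginal hI s x₀).trans ?_
      rw [lintegral_indicator_one hN, hN0]
  filter_upwards [hslice] with x hx
  filter_upwards [(lintegral_eq_zero_iff (hI.comp measurable_updateFinset)).1 hx] with y hy
  by_contra hPy
  simp [hPN hPy] at hy

theorem lmarginal_congr_ae (h : f =ᵐ[Measure.pi μ] g) (s : Finset V) :
    lmarginal μ s f =ᵐ[Measure.pi μ] lmarginal μ s g := by
  filter_upwards [ae_ae_updateFinset h s] with x hx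
  exact lintegral_congr_ae hx

theorem ae_lmarginal_ne_top (hf : Measurable f) (hfin : ∫⁻ x, f x ∂(Measure.pi μ) ≠ ∞)
    (s : Finset V) : ∀ᵐ x ∂(Measure.pi μ), lmarginal μ s f x ≠ ∞ := by
  rcases isEmpty_or_nonempty (∀ v, Ω v) with _ | ⟨⟨x₀⟩⟩
  · exact .of_forall isEmptyElim
  refine ae_of_ae_updateFinset (s := sᶜ) (fun x y h => congrArg (· ≠ ∞) ?_) x₀ ?_
  · exact lmarginal_congr _ _ fun i hi => h i (by simpa using hi)
  · rw [← lmarginal_compl_lmarginal hf s x₀] at hfin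
    filter_upwards [ae_lt_top ((hf.lmarginal μ).comp measurable_updateFinset) hfin] with y hy
    exact hy.ne

theorem ae_lmarginal_ne_zero (hf : Measurable f) (hpos : ∀ᵐ x ∂(Measure.pi μ), 0 < f x)
    (s : Finset V) : ∀ᵐ x ∂(Measure.pi μ), lmarginal μ s f x ≠ 0 := by
  rcases eq_or_ne (Measure.pi μ) 0 with h0 | h0
  · simp [h0]
  have : NeZero (Measure.pi fun i : s => μ i) := ⟨measure_pi_subtype_ne_zero h0 s⟩
  filter_upwards [ae_ae_updateFinset hpos s] with x hx hzero
  have hnull := (lintegral_eq_zero_iff (hf.comp measurable_updateFinset)).1 hzero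
  obtain ⟨y, hy, hy0⟩ := (hx.and hnull).exists
  exact hy.ne' hy0

theorem IsPositiveDensity.lmarginal_ne_zero_ne_top (hf : IsPositiveDensity μ f) (s : Finset V) :
    ∀ᵐ x ∂(Measure.pi μ), lmarginal μ s f x ≠ 0 ∧ lmarginal μ s f x ≠ ∞ := by
  have hfin : ∫⁻ x, f x ∂(Measure.pi μ) ≠ ∞ := by simp [hf.lintegral_eq_one]
  filter_upwards [ae_lmarginal_ne_zero hf.measurable hf.pos s,
    ae_lmarginal_ne_top hf.measurable hfin s] with x h0 htop
  exact ⟨h0, htop⟩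

end LMarginal

/-! ### Independence in kernels -/

theorem ennreal_mul_div_mul_div_mul {a b c d : ℝ≥0∞} (hac : a * c ≠ 0 ∧ a * c ≠ ∞)
    (hdc : d * c ≠ 0 ∧ d * c ≠ ∞) : a * b / (a * c / (d * c)) = d * b := by
  have hc : c ≠ 0 := right_ne_zero_of_mul hac.1
  have ha : a ≠ 0 := left_ne_zero_of_mul hac.1
  have hd : d ≠ 0 := left_ne_zero_of_mul hdc.1
  have hc' : c ≠ ∞ := fun h => hac.2 (by rw [h, ENNReal.mul_top ha])
  have ha' : a ≠ ∞ := fun h => hac.2 (by rw [h, ENNReal.top_mul hc])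
  have hd' : d ≠ ∞ := fun h => hdc.2 (by rw [h, ENNReal.top_mul hc])
  calc a * b / (a * c / (d * c)) = a⁻¹ * a * (d * b) := by
        rw [ENNReal.mul_div_mul_right _ _ hc hc', ENNReal.div_eq_inv_mul,
          ENNReal.inv_div (.inl hd') (.inl hd), ENNReal.div_eq_inv_mul]
        ring
    _ = d * b := by rw [ENNReal.inv_mul_cancel ha ha', one_mul]

section KernelIndep

variable {V : Type*} [Fintype V] [DecidableEq V] {Ω : V → Type*} [∀ v, MeasurableSpace (Ω v)]
  {μ : ∀ v, Measure (Ω v)} [∀ v, SigmaFinite (μ v)] {p q q' f g : (∀ v, Ω v) → ℝ≥0∞}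
  {R S B C : Finset V} {a b v : V}

theorem KernelIndep.congr_ae (h : KernelIndep μ R q a b C) (hq : q =ᵐ[Measure.pi μ] q') :
    KernelIndep μ R q' a b C := by
  filter_upwards [h, lmarginal_congr_ae hq (R \ insert a (insert b C)),
    lmarginal_congr_ae hq (R \ C), lmarginal_congr_ae hq (R \ insert a C),
    lmarginal_congr_ae hq (R \ insert b C)] with x hx h₁ h₂ h₃ h₄
  rwa [← h₁, ← h₂, ← h₃, ← h₄]

theorem kernelIndep_lmarginal (hp : Measurable p) (hRS : Disjoint R S)
    (hC : Disjoint (insert a (insert b C)) S) :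
    KernelIndep μ R (lmarginal μ S p) a b C ↔ KernelIndep μ (R ∪ S) p a b C := by
  have hunion : ∀ T ⊆ insert a (insert b C),
      lmarginal μ ((R ∪ S) \ T) p = lmarginal μ (R \ T) (lmarginal μ S p) := by
    intro T hT
    rw [← lmarginal_union μ p hp (hRS.mono_left Finset.sdiff_subset), Finset.union_sdiff_distrib,
      (hC.mono_left hT).symm.sdiff_eq_left]
  simp only [KernelIndep]
  rw [hunion _ subset_rfl, hunion C (by grind), hunion (insert a C) (by grind),
    hunion (insert b C) (by grind)]

theorem kernelIndep_of_ae_eq_mul (hf : Measurable f) (hg : Measurable g)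
    (hq : q =ᵐ[Measure.pi μ] f * g) (hab : a ≠ b) (ha : a ∉ C) (hb : b ∉ C)
    (hfb : DependsOn f {b}ᶜ) (hga : DependsOn g {a}ᶜ) :
    KernelIndep μ (insert a (insert b C)) q a b C := by
  refine KernelIndep.congr_ae (.of_forall fun x => ?_) hq.symm
  have hsdiff_a : insert a (insert b C) \ insert a C = {b} := by grind
  have hsdiff_b : insert a (insert b C) \ insert b C = {a} := by grind
  have hsdiff : insert a (insert b C) \ C = {a} ∪ {b} := by grind
  rw [← Finset.coe_singleton] at hfb hga
  rw [hsdiff_a, hsdiff_b, hsdiff, Finset.sdiff_self, lmarginal_empty, lmarginal_mul_left hfb hg,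
    lmarginal_mul_right hf hga, lmarginal_union_mul (by simpa using hab) hf hg hfb hga]
  simp only [Pi.mul_apply]
  ring

theorem div_condDensity_ae_eq_lmarginal (hf : Measurable f) (hg : Measurable g)
    (hq : q =ᵐ[Measure.pi μ] f * g) (hvR : v ∈ R) (hvB : v ∉ B)
    (hfB : DependsOn f (insert v B : Finset V)) (hgv : DependsOn g {v}ᶜ)
    (hpos : ∀ s ⊆ R, ∀ᵐ x ∂(Measure.pi μ), lmarginal μ s q x ≠ 0 ∧ lmarginal μ s q x ≠ ∞) :
    q / condDensity μ R q v B =ᵐ[Measure.pi μ] lmarginal μ {v} q := by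
  have hRB : R \ B = {v} ∪ R \ insert v B := by grind
  have hfT : DependsOn f ((R \ insert v B : Finset V) : Set V)ᶜ :=
    hfB.mono fun w hw => by simp_all
  rw [← Finset.coe_singleton] at hgv
  have hlm_T := lmarginal_mul_left (μ := μ) hfT hg
  have hlm_v := lmarginal_mul_right (μ := μ) hf hgv
  have hlm := lmarginal_union_mul (μ := μ) (by simp) hf hg hfT hgv
  filter_upwards [hq, lmarginal_congr_ae hq (R \ insert v B), lmarginal_congr_ae hq {v},
    lmarginal_congr_ae hq (R \ B), hpos (R \ insert v B) Finset.sdiff_subset,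
    hpos (R \ B) Finset.sdiff_subset] with x hx hxT hxv hxB hposT hposB
  rw [hxT, hlm_T] at hposT
  rw [hxB, hRB, hlm] at hposB
  rw [Pi.div_apply, condDensity, hx, hxT, hxv, hxB, hRB, hlm_T, hlm_v, hlm]
  exact ennreal_mul_div_mul_div_mul hposT hposB

end KernelIndep

/-! ### Factorization into districts -/

theorem ADMG.random_fix {V : Type*} [Fintype V] [DecidableEq V] (G : ADMG V) (S : Finset V) :
    (G.fix S).random = Sᶜ := by
  rw [CADMG.random_fix, CADMG.random, G.fixed_eq, Finset.sdiff_empty, ← Finset.compl_eq_univ_sdiff]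

/-- A set of vertices is ancestral if it contains the parents of its elements. -/
def CADMG.Ancestral {V : Type*} (G : CADMG V) (S : Finset V) : Prop :=
  ∀ v w, G.dir v w → w ∈ S → v ∈ S

section Factorization

variable {V : Type*} [Fintype V] [DecidableEq V] {Ω : V → Type*} [∀ v, MeasurableSpace (Ω v)]
  {μ : ∀ v, Measure (Ω v)} {p q : (∀ v, Ω v) → ℝ≥0∞}

/-- The kernel `q` factorizes over the districts of its graph `G`: it is the product of one kernel
for each district, given the parents of that district. -/
def DistrictFactorization (μ : ∀ v, Measure (Ω v)) (G : CADMG V) (q : (∀ v, Ω v) → ℝ≥0∞) : Prop :=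
  ∃ k : Finset V → (∀ v, Ω v) → ℝ≥0∞,
    (∀ D ∈ G.districts, IsKernel μ D (G.parents D) (k D)) ∧
      q =ᵐ[Measure.pi μ] ∏ D ∈ G.districts, k D

theorem NestedMarkov.districtFactorization {G : ADMG V} (hG : NestedMarkov μ p G) {l : List V}
    (hl : G.ValidSeq l) :
    DistrictFactorization μ (G.fix l.toFinset) (fixKernelSeq μ G.toCADMG p l) := by
  obtain ⟨k, hk, hfac⟩ := hG
  refine ⟨k, fun D hD => ?_, ?_⟩
  · have hDl : Disjoint D l.toFinset :=
      Finset.disjoint_of_subset_left (CADMG.subset_random_of_mem_districts hD)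
        (CADMG.random_fix G.toCADMG _ ▸ Finset.sdiff_disjoint)
    rw [CADMG.parents_fix_of_disjoint hDl]
    exact hk D (hl.intrinsic hD)
  · filter_upwards [hfac l hl] with x hx
    rw [hx, Finset.prod_apply]

theorem fixKernelSeq_append_singleton (G : CADMG V) (q : (∀ v, Ω v) → ℝ≥0∞) (l : List V) (v : V) :
    fixKernelSeq μ G q (l ++ [v]) =
      fixKernel μ (G.fix l.toFinset) (fixKernelSeq μ G q l) v := by
  induction l generalizing G q with
  | nil => simp [fixKernelSeq, CADMG.fix_empty]
  | cons u l ih =>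
    simp only [List.cons_append, fixKernelSeq, ih, CADMG.fix_fix, List.toFinset_cons,
      Finset.insert_eq]

variable [∀ v, SigmaFinite (μ v)]

namespace DistrictFactorization

variable {G : CADMG V}

theorem fixKernel_ae_eq_lmarginal (h : DistrictFactorization μ G q) {v : V} (hv : v ∈ G.random)
    (hchild : ∀ w, ¬ G.dir v w) (hpos : ∀ s ⊆ G.random, ∀ᵐ x ∂(Measure.pi μ),
      lmarginal μ s q x ≠ 0 ∧ lmarginal μ s q x ≠ ∞) :
    fixKernel μ G q v =ᵐ[Measure.pi μ] lmarginal μ {v} q := by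
  obtain ⟨k, hk, hq⟩ := h
  have hDv := CADMG.district_mem_districts hv
  rw [← Finset.mul_prod_erase _ _ hDv] at hq
  refine div_condDensity_ae_eq_lmarginal (hk _ hDv).measurable
    (measurable_finsetProd fun D hD => (hk D (Finset.mem_of_mem_erase hD)).measurable)
    hq hv (Finset.notMem_erase v _) ?_ (dependsOn_prod fun D hD => ?_) hpos
  · rw [CADMG.insert_markovBlanket hv]
    exact (hk _ hDv).dependsOn
  · obtain ⟨hne, hD⟩ := Finset.mem_erase.1 hD
    refine (hk D hD).dependsOn.mono (Set.subset_compl_singleton_iff.2 fun hmem => ?_)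
    rcases Finset.mem_union.1 (Finset.mem_coe.1 hmem) with hvD | hvD
    · exact hne (CADMG.eq_district_of_mem hD hvD)
    · obtain ⟨d, -, hd⟩ := CADMG.mem_parents.1 hvD
      exact hchild d hd

theorem kernelIndep (h : DistrictFactorization μ G q) {a b : V} {C T : Finset V}
    (hR : G.random = insert a (insert b C)) (hab : a ≠ b) (haC : a ∉ C) (hbC : b ∉ C)
    (haT : a ∈ T) (hbT : b ∉ T) (hbi : ∀ v w, G.bi v w → v ∈ T → w ∈ T)
    (hb : ∀ w ∈ T, ¬ G.dir b w) (ha : ∀ w ∉ T, ¬ G.dir a w) :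
    KernelIndep μ G.random q a b C := by
  obtain ⟨k, hk, hq⟩ := h
  rw [← Finset.prod_filter_mul_prod_filter_not _ (· ⊆ T)] at hq
  rw [hR]
  refine kernelIndep_of_ae_eq_mul
    (measurable_finsetProd fun D hD => (hk D (Finset.mem_filter.1 hD).1).measurable)
    (measurable_finsetProd fun D hD => (hk D (Finset.mem_filter.1 hD).1).measurable)
    hq hab haC hbC (dependsOn_prod fun D hD => ?_) (dependsOn_prod fun D hD => ?_)
  all_goals
    obtain ⟨hD, hDT⟩ := Finset.mem_filter.1 hD
    refine (hk D hD).dependsOn.mono (Set.subset_compl_singleton_iff.2 fun hmem => ?_)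
    rw [Finset.mem_coe, Finset.mem_union, CADMG.mem_parents] at hmem
  · rcases hmem with hbD | ⟨d, hdD, hd⟩
    exacts [hbT (hDT hbD), hb d (hDT hdD) hd]
  · rcases hmem with haD | ⟨d, hdD, hd⟩
    · exact hDT (CADMG.subset_of_mem_districts hD hbi haD haT)
    · exact ha d (fun hdT => hDT (CADMG.subset_of_mem_districts hD hbi hdD hdT)) hd

end DistrictFactorization

/-! ### The pairwise Markov property -/

namespace NestedMarkov

variable {G : ADMG V}

theorem fixKernelSeq_append_singleton_ae_eq (hp : IsPositiveDensity μ p) (hG : NestedMarkov μ p G)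
    {l : List V} {v : V} (hl : G.ValidSeq l) (hv : v ∈ (G.fix l.toFinset).random)
    (hchild : ∀ w, ¬ (G.fix l.toFinset).dir v w)
    (hmarg : fixKernelSeq μ G.toCADMG p l =ᵐ[Measure.pi μ] lmarginal μ l.toFinset p) :
    fixKernelSeq μ G.toCADMG p (l ++ [v]) =ᵐ[Measure.pi μ]
      lmarginal μ (insert v l.toFinset) p := by
  have hunion : ∀ s ⊆ (G.fix l.toFinset).random,
      lmarginal μ s (fixKernelSeq μ G.toCADMG p l) =ᵐ[Measure.pi μ]
        lmarginal μ (s ∪ l.toFinset) p := by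
    intro s hs
    rw [ADMG.random_fix] at hs
    rw [lmarginal_union μ p hp.measurable (Finset.disjoint_of_subset_left hs disjoint_compl_left)]
    exact lmarginal_congr_ae hmarg s
  rw [fixKernelSeq_append_singleton, Finset.insert_eq]
  refine ((hG.districtFactorization hl).fixKernel_ae_eq_lmarginal hv hchild fun s hs => ?_).trans
    (hunion {v} (Finset.singleton_subset_iff.2 hv))
  filter_upwards [hunion s hs, hp.lmarginal_ne_zero_ne_top (s ∪ l.toFinset)] with x hx hpos
  rwa [hx]

theorem exists_validSeq_ae_eq_lmarginal (hp : IsPositiveDensity μ p) (hG : NestedMarkov μ p G)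
    {S : Finset V} (hS : G.Ancestral S) :
    ∃ l, G.ValidSeq l ∧ l.toFinset = Sᶜ ∧
      fixKernelSeq μ G.toCADMG p l =ᵐ[Measure.pi μ] lmarginal μ Sᶜ p := by
  induction hn : Sᶜ.card generalizing S with
  | zero =>
    rw [Finset.card_eq_zero.1 hn, lmarginal_empty]
    exact ⟨[], trivial, rfl, .rfl⟩
  | succ n ih =>
    obtain ⟨v, hvS, hfirst⟩ := exists_forall_not_transGen G.acyclic
      (Finset.card_pos.1 (by omega : 0 < Sᶜ.card))
    have hcompl : insert v (insert v S)ᶜ = Sᶜ := by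
      rw [Finset.compl_insert, Finset.insert_erase hvS]
    have hinsert : G.Ancestral (insert v S) := by
      intro u w huw hw
      rcases Finset.mem_insert.1 hw with rfl | hw
      · have huS : u ∉ Sᶜ := fun h => hfirst u h (.single huw)
        exact Finset.mem_insert_of_mem (by simpa using huS)
      · exact Finset.mem_insert_of_mem (hS u w huw hw)
    obtain ⟨l, hl, hlS, hmarg⟩ := ih hinsert
      (by rw [Finset.compl_insert, Finset.card_erase_of_mem hvS, hn, Nat.add_sub_cancel])
    have hv : v ∈ (G.fix l.toFinset).random := by simp [ADMG.random_fix, hlS]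
    have hchild : ∀ w, ¬ (G.fix l.toFinset).dir v w := by
      rintro w ⟨hvw, hw⟩
      rw [hlS, Finset.notMem_compl, Finset.mem_insert] at hw
      rcases hw with rfl | hw
      exacts [G.acyclic w (.single hvw), Finset.mem_compl.1 hvS (hS v w hvw hw)]
    refine ⟨l ++ [v], hl.append ⟨CADMG.fixable_of_childless hv hchild, trivial⟩, ?_, ?_⟩
    · rw [← hcompl, ← hlS, List.toFinset_append, Finset.union_comm]
      rfl
    · rw [← hcompl, ← hlS]
      exact hG.fixKernelSeq_append_singleton_ae_eq hp hl hv hchild (hlS ▸ hmarg)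

theorem districtFactorization_lmarginal (hp : IsPositiveDensity μ p) (hG : NestedMarkov μ p G)
    {S : Finset V} (hS : G.Ancestral S) :
    DistrictFactorization μ (G.fix Sᶜ) (lmarginal μ Sᶜ p) := by
  obtain ⟨l, hl, hlS, hmarg⟩ := hG.exists_validSeq_ae_eq_lmarginal hp hS
  obtain ⟨k, hk, hfac⟩ := hG.districtFactorization hl
  exact hlS ▸ ⟨k, hk, (hlS ▸ hmarg).symm.trans hfac⟩

theorem ordIndep (hp : IsPositiveDensity μ p) (hG : NestedMarkov μ p G) {a b : V} {C T : Finset V}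
    (hS : G.Ancestral (insert a (insert b C))) (hab : a ≠ b) (haC : a ∉ C) (hbC : b ∉ C)
    (haT : a ∈ T) (hbT : b ∉ T)
    (hbi : ∀ v ∈ T, ∀ w ∈ insert a (insert b C) \ T, ¬ G.bi v w)
    (hb : ∀ w ∈ T, ¬ G.dir b w) (ha : ∀ w ∈ insert a (insert b C) \ T, ¬ G.dir a w) :
    OrdIndep μ p a b C := by
  set S := insert a (insert b C)
  have hrandom : (G.fix Sᶜ).random = S := by rw [ADMG.random_fix, compl_compl]
  have hmem : ∀ w, w ∉ Sᶜ → w ∉ T → w ∈ S \ T := fun w hw hwT =>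
    Finset.mem_sdiff.2 ⟨Finset.notMem_compl.1 hw, hwT⟩
  have hindep := (hG.districtFactorization_lmarginal hp hS).kernelIndep (T := T) hrandom hab haC
    hbC haT hbT (fun v w h hv => by_contra fun hw => hbi v hv w (hmem w h.2.2 hw) h.1)
    (fun w hw h => hb w hw h.1) (fun w hw h => ha w (hmem w h.2 hw) h.1)
  rw [hrandom, kernelIndep_lmarginal hp.measurable disjoint_compl_right disjoint_compl_right,
    Finset.union_compl] at hindep
  exact hindep

end NestedMarkov

end Factorization

/-! ### Anchor, treatment, mediator and outcome -/

/-- The position of a variable in the causal order `Z, A, M, Y`. -/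
def Var.rank : Var → ℕ
  | .Z => 0
  | .A => 1
  | .M => 2
  | .Y => 3

theorem topologicalOrder_rank {G : ADMG Var} (h : Mediation G)
    (hAZ : ¬ Relation.TransGen G.dir .A .Z) : TopologicalOrder G Var.rank := by
  obtain ⟨hAM, hMY⟩ := h
  refine ⟨by decide, fun a b hab => ?_⟩
  by_contra! hle
  cases b with
  | Z =>
    cases a with
    | Z => exact G.acyclic _ (.single hab)
    | A => exact hAZ (.single hab)
    | M => exact hAZ (.tail (.single hAM) hab)
    | Y => exact hAZ (.tail (.tail (.single hAM) hMY) hab)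
  | A =>
    cases a with
    | Z => simp [Var.rank] at hle
    | A => exact G.acyclic _ (.single hab)
    | M => exact G.acyclic _ (.tail (.single hAM) hab)
    | Y => exact G.acyclic _ (.tail (.tail (.single hAM) hMY) hab)
  | M =>
    cases a with
    | Z | A => simp [Var.rank] at hle
    | M => exact G.acyclic _ (.single hab)
    | Y => exact G.acyclic _ (.tail (.single hMY) hab)
  | Y =>
    cases a with
    | Z | A | M => simp [Var.rank] at hle
    | Y => exact G.acyclic _ (.single hab)

theorem TopologicalOrder.not_dir {V : Type*} {G : ADMG V} {ord : V → ℕ}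
    (h : TopologicalOrder G ord) {a b : V} (hab : ord b ≤ ord a) : ¬ G.dir a b :=
  fun hd => (h.2 a b hd).not_ge hab

theorem TopologicalOrder.ancestral {V : Type*} {G : ADMG V} {ord : V → ℕ}
    (h : TopologicalOrder G ord) {S : Finset V} (hS : ∀ v w, ord v < ord w → w ∈ S → v ∈ S) :
    G.Ancestral S :=
  fun v w hd => hS v w (h.2 v w hd)

theorem eq_A_of_edge_Z {G : ADMG Var} (hZM : ∀ e, ¬ G.Edge e .Z .M)
    (hZY : ∀ e, ¬ G.Edge e .Z .Y) (e : EdgeMark) (w : Var) (h : G.Edge e .Z w) : w = .A := by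
  cases w with
  | Z =>
    cases e
    exacts [(G.acyclic _ (.single h)).elim, (G.acyclic _ (.single h)).elim,
      (G.bi_irrefl _ h).elim]
  | A => rfl
  | M => exact (hZM e h).elim
  | Y => exact (hZY e h).elim

theorem Instrument1.exists_edge {G : ADMG Var} (h : Instrument1 G) :
    ∃ e : EdgeMark, e.HeadAtEnd ∧ G.Edge e .Z .A :=
  h.elim (fun hd => ⟨.fwd, trivial, hd⟩) (fun hb => ⟨.both, trivial, hb⟩)

section FourVariables

variable {Ω : Var → Type*} [∀ v, MeasurableSpace (Ω v)] {μ : ∀ v, Measure (Ω v)}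
  {p : (∀ v, Ω v) → ℝ≥0∞} {G : ADMG Var}

theorem VermaConstraint.kernelIndep_gFormula (h : VermaConstraint μ p) :
    KernelIndep μ (Finset.univ \ {.M}) (gFormula μ Var.rank {.M} p) .Z .Y ∅ := by
  have hrandom : (Finset.univ \ {.M} : Finset Var) = {.Z, .A, .Y} := by decide
  have hpred : (Finset.univ.filter fun w => Var.rank w < Var.rank .M) = {Var.A, Var.Z} := by decide
  unfold gFormula
  simp only [Finset.prod_singleton, hpred, hrandom]
  exact h

variable [∀ v, SigmaFinite (μ v)]

theorem instrument1_of_not_ordIndep (hp : IsPositiveDensity μ p) (hG : NestedMarkov μ p G)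
    (hord : TopologicalOrder G Var.rank) (hZA : ¬ OrdIndep μ p .Z .A ∅) : Instrument1 G := by
  by_contra h
  rw [Instrument1, not_or] at h
  have hsdiff : (insert .Z (insert .A ∅) \ {.Z} : Finset Var) = {.A} := by decide
  refine hZA (hG.ordIndep hp (T := {.Z}) (hord.ancestral (by decide)) (by decide) (by simp)
    (by simp) (by simp) (by simp) ?_ ?_ ?_)
  · simpa [hsdiff] using h.2
  · simpa using hord.not_dir (by decide)
  · simpa [hsdiff] using h.1

theorem ordIndep_Z_Y (hp : IsPositiveDensity μ p) (hG : NestedMarkov μ p G)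
    (hord : TopologicalOrder G Var.rank) (hZ : ∀ e w, G.Edge e .Z w → w = .A)
    (hAM : ¬ G.bi .A .M) (hAY : ¬ G.bi .A .Y) : OrdIndep μ p .Z .Y {.A, .M} := by
  have hsdiff : (insert .Z (insert .Y {.A, .M}) \ {.Z, .A} : Finset Var) = {.Y, .M} := by decide
  refine hG.ordIndep hp (T := {.Z, .A}) (hord.ancestral (by decide)) (by decide) (by decide)
    (by decide) (by decide) (by decide) ?_ ?_ ?_
  · have hZb : ∀ w, w ≠ .A → ¬ G.bi .Z w := fun w hw h => hw (hZ .both w h)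
    simp [hsdiff, hZb, hAM, hAY]
  · exact fun w hw => hord.not_dir (by revert w; decide)
  · intro w hw h
    rw [hZ .fwd w h] at hw
    revert hw
    decide

theorem not_ordIndep_Z_Y (hp : IsPositiveDensity μ p) (hG : NestedMarkov μ p G)
    (hA1 : Mediation G) (hA2 : Anchor μ p G) (hA3 : VermaFaithful μ p G)
    (hI1 : Instrument1 G) (hZM : ∀ e, ¬ G.Edge e .Z .M) (hAM : ¬ G.bi .A .M)
    {C : Finset Var} (hZC : .Z ∉ C) (hYC : .Y ∉ C) : ¬ OrdIndep μ p .Z .Y C := by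
  intro hind
  have hord := topologicalOrder_rank hA1 hA2.1
  obtain ⟨e, hhead, he⟩ := hI1.exists_edge
  have hfixed : ∀ v, v ∉ G.fixed := by simp [G.fixed_eq]
  have sep := hA3.ordinary _ _ _ (by decide) hZC hYC hind
  by_cases hC : ∃ c ∈ C, Relation.ReflTransGen G.dir .A c
  · have hAY := sep.not_bi_of_collider (by decide) he hhead hC
    have hZ := eq_A_of_edge_Z hZM fun e => sep.not_edge (by decide)
    exact hA2.2.2 (ordIndep_Z_Y hp hG hord hZ hAM hAY)
  · have hAC : .A ∉ C := fun h => hC ⟨_, h, .refl⟩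
    have hMC : .M ∉ C := fun h => hC ⟨_, h, .single hA1.1⟩
    exact sep (CADMG.mConnected_of_three_edges (e' := .fwd) (e'' := .fwd) (by decide) he hA1.1
      hA1.2 (CADMG.openAt_fwd hAC (hfixed _)) (CADMG.openAt_fwd hMC (hfixed _)))

end FourVariables

theorem corollary1 {Ω : Var → Type*} [∀ v, MeasurableSpace (Ω v)]
    (μ : ∀ v, Measure (Ω v)) [∀ v, SigmaFinite (μ v)]
    (p : (∀ v, Ω v) → ℝ≥0∞) (hp : IsPositiveDensity μ p)
    (G : ADMG Var) (hG : NestedMarkov μ p G)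
    (hA1 : Mediation G) (hA2 : Anchor μ p G) (hA3 : VermaFaithful μ p G)
    (hVerma : VermaConstraint μ p) (hZM : OrdIndep μ p .Z .M {.A}) :
    NestedMarkov μ p G ∧ FrontDoor1 G ∧ FrontDoor2 G ∧ Instrument1 G ∧ Instrument2 G := by
  have hord := topologicalOrder_rank hA1 hA2.1
  have hI1 := instrument1_of_not_ordIndep hp hG hord hA2.2.1
  obtain ⟨e, hhead, he⟩ := hI1.exists_edge
  have sepZM := hA3.ordinary _ _ _ (by decide) (by decide) (by decide) hZM
  have hZM_edge : ∀ e, ¬ G.Edge e .Z .M := fun e => sepZM.not_edge (by decide)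
  have hAM : ¬ G.bi .A .M :=
    sepZM.not_bi_of_collider (by decide) he hhead ⟨.A, Finset.mem_singleton_self _, .refl⟩
  have hdep : ∀ C : Finset Var, .Z ∉ C → .Y ∉ C → ¬ OrdIndep μ p .Z .Y C := fun _ =>
    not_ordIndep_Z_Y hp hG hA1 hA2 hA3 hI1 hZM_edge hAM
  obtain ⟨hident, sepZY⟩ := hA3.generalized _ hord _ _ _ _ (by decide) (by decide)
    (by decide) (by decide) (by decide) (by decide)
    hdep hVerma.kernelIndep_gFormula
  have hZY_edge : ∀ e, ¬ G.Edge e .Z .Y := fun e h =>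
    sepZY.not_edge (by decide) (h.fix (by decide) (by decide))
  have hMY : ¬ G.bi .M .Y := hident.not_bi_of_dir hA1.2 (by decide) (by decide)
  have hAY : ¬ G.dir .A .Y := fun h =>
    sepZY.not_dir_of_edge (by decide) (he.fix (by decide) (by decide)) (by decide)
      (by simp [CADMG.fix, G.fixed_eq]) ⟨h, by decide⟩
  exact ⟨hG, hAY, ⟨hAM, hMY⟩, hI1,
    CADMG.mSeparated_deleteVertex (by decide) (eq_A_of_edge_Z hZM_edge hZY_edge)⟩
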